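/- Let $X$ be a nonzero real Banach space with topological dual $X^*$. Let $\mathscr{C}(X)$ be the set of all functions $f:X\to\mathbb{R}\cup\{+\infty\}$ that are convex, lower semicontinuous for the norm topology, and proper (that is, not identically $+\infty$), ordered pointwise: $f\le g$ means $f(x)\le g(x)$ for all $x\in X$. An operator $T:\mathscr{C}(X)\to\mathscr{C}(X)$ is called fully order preserving if it is onto and, for all $f,g\in\mathscr{C}(X)$, $f\le g$ if and only if $T(f)\le T(g)$. Then an operator $T:\mathscr{C}(X)\to\mathscr{C}(X)$ is fully order preserving if and only if there exist $c\in X$, $w\in X^*$, $\beta\in\mathbb{R}$, $\tau>0$ and a continuous linear automorphism $E$ of $X$ such that $$T(f)(x)=\tau f(Ex+c)+\langle w,x\rangle+\beta$$ for all $f\in\mathscr{C}(X)$ and all $x\in X$. -/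

import Mathlib

/-- A function `f : X → ℝ ∪ {+∞}` (modelled as an `EReal`-valued function that never takes the
value `-∞`) that is proper (not identically `+∞`), convex, and lower semicontinuous for the norm
topology. In the convexity inequality `0 * ⊤ = 0` in `EReal`, so the cases `a = 0` and `b = 0` are
trivial. -/
structure IsLscProperConvex {X : Type*} [NormedAddCommGroup X] [NormedSpace ℝ X]
    (f : X → EReal) : Prop where
  ne_bot : ∀ x, f x ≠ ⊥
  proper : ∃ x, f x ≠ ⊤
  convex : ∀ (x y : X) (a b : ℝ), 0 ≤ a → 0 ≤ b → a + b = 1 →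
    f (a • x + b • y) ≤ (a : EReal) * f x + (b : EReal) * f y
  lsc : LowerSemicontinuous f

/-- The set `C(X)` of lower semicontinuous proper convex functions on `X`, with the pointwise
order (inherited from `X → EReal`). -/
abbrev LscProperConvex (X : Type*) [NormedAddCommGroup X] [NormedSpace ℝ X] : Type _ :=
  {f : X → EReal // IsLscProperConvex f}

/-- `T : C(X) → C(X)` is fully order preserving: `f ≤ g` iff `T f ≤ T g`, and `T` is onto. -/
def FullyOrderPreserving {X : Type*} [NormedAddCommGroup X] [NormedSpace ℝ X]
    (T : LscProperConvex X → LscProperConvex X) : Prop :=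
  (∀ f g : LscProperConvex X, f ≤ g ↔ T f ≤ T g) ∧ Function.Surjective T

section OrderPreserving

variable {X : Type*} [NormedAddCommGroup X] [NormedSpace ℝ X]

/-! The functions finite at a single point, `pointFun x r`, represent the points `(x, r)` of `X ×
ℝ`, and `f ≤ pointFun x r` says that `(x, r)` lies in the epigraph of `f`. Both these functions and
the segments between them (up to raising the height) are described by the order alone, so `T`
induces a bijection of `X × ℝ` that respects vertical lines and segments. Such a map is affine:
fibrewise by Pexider's equation, then globally because the fibre slope is positive on all of `X` and
hence constant. Epigraphs then give the formula for `T f`; continuity follows from semicontinuity of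
the images of continuous functionals and the closed graph theorem. -/

theorem EReal.eq_of_forall_le_coe_iff {a b : EReal} (h : ∀ r : ℝ, a ≤ r ↔ b ≤ r) : a = b :=
  le_antisymm (EReal.le_of_forall_lt_iff_le.1 fun r hr => (h r).2 hr.le)
    (EReal.le_of_forall_lt_iff_le.1 fun r hr => (h r).1 hr.le)

theorem EReal.mul_add_add_le_coe_iff {τ : ℝ} (hτ : 0 < τ) (a : EReal) (w β r : ℝ) :
    (τ : EReal) * a + (w : EReal) + (β : EReal) ≤ (r : EReal) ↔
      a ≤ (((r - w - β) / τ : ℝ) : EReal) := by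
  induction a with
  | bot => simp [EReal.coe_mul_bot_of_pos hτ]
  | top =>
    rw [EReal.coe_mul_top_of_pos hτ, EReal.top_add_coe, EReal.top_add_coe]
    simp
  | coe a =>
    norm_cast
    rw [le_div_iff₀ hτ]
    constructor <;> intro h <;> linarith

theorem IsLscProperConvex.le_of_le {g : X → EReal} (hg : IsLscProperConvex g) {x y : X}
    {a b r s : ℝ} (ha : 0 ≤ a) (hb : 0 ≤ b) (hab : a + b = 1) (hx : g x ≤ r) (hy : g y ≤ s) :
    g (a • x + b • y) ≤ ((a * r + b * s : ℝ) : EReal) := by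
  refine (hg.convex x y a b ha hb hab).trans ?_
  push_cast
  exact add_le_add (mul_le_mul_of_nonneg_left hx (by exact_mod_cast ha))
    (mul_le_mul_of_nonneg_left hy (by exact_mod_cast hb))

/-- Convexity of an extended-real function need only be tested on its epigraph. -/
theorem convex_of_le_coe {f : X → EReal} (hbot : ∀ x, f x ≠ ⊥)
    (h : ∀ (x y : X) (a b r s : ℝ), 0 < a → 0 < b → a + b = 1 → f x ≤ r → f y ≤ s →
      f (a • x + b • y) ≤ ((a * r + b * s : ℝ) : EReal))
    (x y : X) (a b : ℝ) (ha : 0 ≤ a) (hb : 0 ≤ b) (hab : a + b = 1) :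
    f (a • x + b • y) ≤ (a : EReal) * f x + (b : EReal) * f y := by
  rcases ha.eq_or_lt with rfl | ha
  · obtain rfl : b = 1 := by linarith
    simp
  rcases hb.eq_or_lt with rfl | hb
  · obtain rfl : a = 1 := by linarith
    simp
  have hx := hbot x
  have hy := hbot y
  have key := h x y a b
  generalize f x = u at *
  generalize f y = v at *
  induction u with
  | bot => exact absurd rfl hx
  | top =>
    rw [EReal.coe_mul_top_of_pos ha]
    induction v with
    | bot => exact absurd rfl hy
    | top => rw [EReal.coe_mul_top_of_pos hb]; simp
    | coe s => rw [← EReal.coe_mul, EReal.top_add_coe]; exact le_top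
  | coe r =>
    induction v with
    | bot => exact absurd rfl hy
    | top => rw [EReal.coe_mul_top_of_pos hb, ← EReal.coe_mul, EReal.coe_add_top]; exact le_top
    | coe s =>
      have := key r s ha hb hab le_rfl le_rfl
      rwa [EReal.coe_add, EReal.coe_mul, EReal.coe_mul] at this

open Classical in
/-- A continuous affine function restricted to a closed convex set and extended by `⊤`. -/
noncomputable def affineOn (C : Set X) (u : StrongDual ℝ X) (b : ℝ) (x : X) : EReal :=
  if x ∈ C then ((u x + b : ℝ) : EReal) else ⊤

theorem affineOn_le_coe_iff {C : Set X} {u : StrongDual ℝ X} {b r : ℝ} {x : X} :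
    affineOn C u b x ≤ (r : EReal) ↔ x ∈ C ∧ u x + b ≤ r := by
  unfold affineOn
  split_ifs with h
  · simp only [EReal.coe_le_coe_iff, h, true_and]
  · simp [h]

theorem isLscProperConvex_affineOn {C : Set X} (hC : Convex ℝ C) (hcl : IsClosed C)
    (hne : C.Nonempty) (u : StrongDual ℝ X) (b : ℝ) : IsLscProperConvex (affineOn C u b) where
  ne_bot x := by
    unfold affineOn
    split_ifs
    · exact EReal.coe_ne_bot _
    · simp
  proper := by
    obtain ⟨x, hx⟩ := hne
    exact ⟨x, by rw [affineOn, if_pos hx]; exact EReal.coe_ne_top _⟩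
  convex := by
    refine convex_of_le_coe (fun x => ?_) fun x y a c r s ha hc hac hx hy => ?_
    · unfold affineOn
      split_ifs
      · exact EReal.coe_ne_bot _
      · simp
    · rw [affineOn_le_coe_iff] at *
      refine ⟨hC hx.1 hy.1 ha.le hc.le hac, ?_⟩
      simp only [map_add, map_smul, smul_eq_mul]
      have h1 := mul_le_mul_of_nonneg_left hx.2 ha.le
      have h2 := mul_le_mul_of_nonneg_left hy.2 hc.le
      have h3 : b = a * b + c * b := by rw [← add_mul, hac, one_mul]
      linarith
  lsc := by
    rw [lowerSemicontinuous_iff_isClosed_preimage]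
    intro y
    induction y with
    | bot =>
      convert isClosed_empty
      ext x
      simp only [Set.mem_preimage, Set.mem_Iic, le_bot_iff, Set.mem_empty_iff_false, iff_false]
      unfold affineOn
      split_ifs
      · exact EReal.coe_ne_bot _
      · simp
    | top => simp
    | coe r =>
      have : affineOn C u b ⁻¹' Set.Iic (r : EReal) = C ∩ {x | u x + b ≤ r} := by
        ext x
        exact affineOn_le_coe_iff
      rw [this]
      exact hcl.inter (isClosed_le (by fun_prop) continuous_const)

/-! ### Point functions and their description by the order -/

/-- The function with value `r` at `x` and `⊤` elsewhere. -/
noncomputable def pointFun (x : X) (r : ℝ) : LscProperConvex X :=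
  ⟨affineOn {x} 0 r,
    isLscProperConvex_affineOn (convex_singleton x) isClosed_singleton ⟨x, rfl⟩ 0 r⟩

theorem le_pointFun_iff {f : LscProperConvex X} {x : X} {r : ℝ} :
    f ≤ pointFun x r ↔ f.1 x ≤ r := by
  constructor
  · intro h
    have := h x
    simpa [pointFun, affineOn] using this
  · intro h y
    change f.1 y ≤ affineOn {x} 0 r y
    unfold affineOn
    split_ifs with hy
    · obtain rfl : y = x := hy
      simpa using h
    · exact le_top

theorem pointFun_le_pointFun_iff {x y : X} {r s : ℝ} :
    pointFun x r ≤ pointFun y s ↔ y = x ∧ r ≤ s := by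
  rw [le_pointFun_iff]
  change affineOn {x} 0 r y ≤ s ↔ _
  rw [affineOn_le_coe_iff]
  simp

/-- Point functions are the elements whose majorants form a chain. -/
theorem exists_eq_pointFun_iff {f : LscProperConvex X} :
    (∃ x r, f = pointFun x r) ↔ ∀ g h, f ≤ g → f ≤ h → g ≤ h ∨ h ≤ g := by
  constructor
  · rintro ⟨x, r, rfl⟩ g h hg hh
    have key : ∀ k : LscProperConvex X, pointFun x r ≤ k → ∃ s : ℝ, k = pointFun x s := by
      intro k hk
      have htop : ∀ y, y ≠ x → k.1 y = ⊤ := by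
        intro y hy
        have := hk y
        change affineOn {x} 0 r y ≤ k.1 y at this
        rw [affineOn, if_neg (by simpa using hy)] at this
        exact top_le_iff.1 this
      have hx : k.1 x ≠ ⊤ := by
        obtain ⟨y, hy⟩ := k.2.proper
        by_cases h : y = x
        · rwa [h] at hy
        · exact absurd (htop y h) hy
      refine ⟨(k.1 x).toReal, Subtype.ext (funext fun y => ?_)⟩
      change _ = affineOn {x} 0 _ y
      unfold affineOn
      split_ifs with hy
      · obtain rfl : y = x := hy
        simp [EReal.coe_toReal hx (k.2.ne_bot _)]
      · exact htop y hy
    obtain ⟨s, rfl⟩ := key g hg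
    obtain ⟨t, rfl⟩ := key h hh
    simp only [pointFun_le_pointFun_iff, true_and]
    exact le_total s t
  · intro H
    obtain ⟨x, hx⟩ := f.2.proper
    have hfx : f ≤ pointFun x (f.1 x).toReal := by
      rw [le_pointFun_iff, EReal.coe_toReal hx (f.2.ne_bot x)]
    refine ⟨x, (f.1 x).toReal, le_antisymm hfx fun y => ?_⟩
    change affineOn {x} 0 _ y ≤ f.1 y
    unfold affineOn
    split_ifs with hy
    · obtain rfl : y = x := hy
      simp [EReal.coe_toReal hx (f.2.ne_bot _)]
    · rw [top_le_iff]
      by_contra hfy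
      have hfy' : f ≤ pointFun y (f.1 y).toReal := by
        rw [le_pointFun_iff, EReal.coe_toReal hfy (f.2.ne_bot y)]
      rcases H _ _ hfx hfy' with h | h
      · exact hy (pointFun_le_pointFun_iff.1 h).1
      · exact hy (pointFun_le_pointFun_iff.1 h).1.symm

/-- Points of the segment between two points of `X × ℝ`, or above it, are exactly those satisfied
by every common minorant of the two point functions. -/
theorem forall_le_pointFun_iff {x y z : X} {r s q : ℝ} (hxy : x ≠ y) :
    (∀ g : LscProperConvex X, g ≤ pointFun x r → g ≤ pointFun y s → g ≤ pointFun z q) ↔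
      ∃ a b : ℝ, 0 ≤ a ∧ 0 ≤ b ∧ a + b = 1 ∧ z = a • x + b • y ∧ a * r + b * s ≤ q := by
  simp only [le_pointFun_iff]
  constructor
  · intro H
    have hz : z ∈ segment ℝ x y := by
      have hcl : IsClosed (segment ℝ x y) := by
        rw [segment_eq_image_lineMap]
        exact (isCompact_Icc.image (by fun_prop)).isClosed
      -- A minorant equal to `⊤` off the segment forces `z` into the segment.
      have := H ⟨_, isLscProperConvex_affineOn (convex_segment x y) hcl
        ⟨x, left_mem_segment ℝ x y⟩ 0 (min r s)⟩
        (affineOn_le_coe_iff.2 ⟨left_mem_segment ℝ x y, by simp⟩)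
        (affineOn_le_coe_iff.2 ⟨right_mem_segment ℝ x y, by simp⟩)
      by_contra hz
      simp [affineOn, hz] at this
    obtain ⟨a, b, ha, hb, hab, rfl⟩ := hz
    refine ⟨a, b, ha, hb, hab, rfl, ?_⟩
    obtain ⟨u, hu⟩ := SeparatingDual.exists_separating_of_ne (R := ℝ) hxy
    have hu' : u x - u y ≠ 0 := sub_ne_zero.2 hu
    -- The continuous affine function through `(x, r)` and `(y, s)` gives the sharp bound on the
    -- height.
    have := H ⟨_, isLscProperConvex_affineOn convex_univ isClosed_univ
        ⟨x, trivial⟩ (((r - s) / (u x - u y)) • u) (r - (r - s) / (u x - u y) * u x)⟩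
        (affineOn_le_coe_iff.2 ⟨trivial, by simp⟩)
        (affineOn_le_coe_iff.2 ⟨trivial, le_of_eq (by
          simp only [smul_apply, smul_eq_mul]
          field_simp
          ring)⟩)
    have := (affineOn_le_coe_iff.1 this).2
    convert this using 1
    obtain rfl : b = 1 - a := by linarith
    simp only [smul_apply, map_add, map_smul, smul_eq_mul]
    field_simp
    ring
  · rintro ⟨a, b, ha, hb, hab, rfl, hq⟩ g hx hy
    exact (g.2.le_of_le ha hb hab hx hy).trans (by exact_mod_cast hq)

/-! ### Operators of the stated form preserve the order -/

theorem IsLscProperConvex.comp_affine {f : X → EReal} (hf : IsLscProperConvex f) (E : X ≃L[ℝ] X)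
    (c : X) (w : StrongDual ℝ X) (β : ℝ) {τ : ℝ} (hτ : 0 < τ) :
    IsLscProperConvex fun x =>
      (τ : EReal) * f (E x + c) + ((w x : ℝ) : EReal) + (β : EReal) := by
  have hbot : ∀ x, (τ : EReal) * f (E x + c) + ((w x : ℝ) : EReal) + (β : EReal) ≠ ⊥ := by
    intro x
    have h := hf.ne_bot (E x + c)
    generalize f (E x + c) = v at *
    induction v with
    | bot => exact absurd rfl h
    | top => simp [EReal.coe_mul_top_of_pos hτ]
    | coe v => norm_cast; exact EReal.coe_ne_bot _
  refine ⟨hbot, ?_, convex_of_le_coe hbot ?_, ?_⟩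
  · obtain ⟨x, hx⟩ := hf.proper
    refine ⟨E.symm (x - c), ?_⟩
    simp only [ContinuousLinearEquiv.apply_symm_apply, sub_add_cancel]
    have h := hf.ne_bot x
    generalize f x = v at *
    induction v with
    | bot => exact absurd rfl h
    | top => exact absurd rfl hx
    | coe v => norm_cast; exact EReal.coe_ne_top _
  · intro x y a b r s ha hb hab hx hy
    rw [EReal.mul_add_add_le_coe_iff hτ] at *
    have := hf.le_of_le ha.le hb.le hab hx hy
    have e : E (a • x + b • y) + c = a • (E x + c) + b • (E y + c) := by
      obtain rfl : b = 1 - a := by linarith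
      simp only [map_add, map_smul]
      module
    rw [e]
    convert this using 2
    obtain rfl : b = 1 - a := by linarith
    simp only [map_add, map_smul, smul_eq_mul]
    ring
  · have h1 : LowerSemicontinuous fun x => (τ : EReal) * f (E x + c) := by
      refine Continuous.comp_lowerSemicontinuous (g := fun v : EReal => (τ : EReal) * v)
        (f := fun x => f (E x + c)) ?_ (hf.lsc.comp (g := fun x => E x + c) (by fun_prop)) ?_
      · exact continuous_iff_continuousAt.2 fun v => EReal.Tendsto.const_mul Filter.tendsto_id
          (Or.inl (by simp)) (Or.inl (by simp))
      · exact fun u v huv => mul_le_mul_of_nonneg_left huv (by exact_mod_cast hτ.le)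
    refine LowerSemicontinuous.add' (LowerSemicontinuous.add' h1
      (continuous_coe_real_ereal.comp w.continuous).lowerSemicontinuous ?_)
      continuous_const.lowerSemicontinuous ?_
    · exact fun x => EReal.continuousAt_add (Or.inr (by simp)) (Or.inr (by simp))
    · exact fun x => EReal.continuousAt_add (Or.inr (by simp)) (Or.inr (by simp))

theorem fullyOrderPreserving_of_eq {T : LscProperConvex X → LscProperConvex X} {c : X}
    {w : StrongDual ℝ X} {β τ : ℝ} {E : X ≃L[ℝ] X} (hτ : 0 < τ)
    (hT : ∀ (f : LscProperConvex X) (x : X),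
      (T f).1 x = (τ : EReal) * f.1 (E x + c) + ((w x : ℝ) : EReal) + (β : EReal)) :
    FullyOrderPreserving T := by
  have hle : ∀ (f : LscProperConvex X) (x : X) (r : ℝ),
      (T f).1 x ≤ r ↔ f.1 (E x + c) ≤ (((r - w x - β) / τ : ℝ) : EReal) := fun f x r => by
    rw [hT, EReal.mul_add_add_le_coe_iff hτ]
  refine ⟨fun f g => ⟨fun h x => ?_, fun h x => ?_⟩, fun g => ?_⟩
  · refine EReal.le_of_forall_lt_iff_le.1 fun r hr => ?_
    exact (hle f x r).2 ((h _).trans ((hle g x r).1 hr.le))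
  · refine EReal.le_of_forall_lt_iff_le.1 fun r hr => ?_
    obtain ⟨y, rfl⟩ : ∃ y, E y + c = x := ⟨E.symm (x - c), by simp⟩
    obtain ⟨s, rfl⟩ : ∃ s, (s - w y - β) / τ = r :=
      ⟨τ * r + w y + β, by field_simp; ring⟩
    exact (hle f y s).1 ((h y).trans ((hle g y s).2 hr.le))
  -- Solving `g = T f` for `f` gives an operator of the same form.
  · refine ⟨⟨_, g.2.comp_affine E.symm (-E.symm c) (-(τ⁻¹ • w.comp (E.symm : X →L[ℝ] X)))
      (τ⁻¹ * (w (E.symm c) - β)) (inv_pos.2 hτ)⟩, Subtype.ext (funext fun x => ?_)⟩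
    refine EReal.eq_of_forall_le_coe_iff fun r => ?_
    rw [hle, EReal.mul_add_add_le_coe_iff (inv_pos.2 hτ)]
    have e1 : E.symm (E x + c) + -E.symm c = x := by simp
    rw [e1]
    congr! 2
    simp
    field_simp
    ring


/-! ### Functional equations and automatic continuity -/

/-- A monotone surjective solution of Pexider's functional equation is affine. -/
theorem exists_affine_of_pexider {F g h : ℝ → ℝ} (hF : StrictMono F)
    (hsurj : Function.Surjective F) {a b : ℝ} (ha : a ≠ 0) (hb : b ≠ 0)
    (H : ∀ r s, F (a * r + b * s) = g r + h s) : ∃ τ β : ℝ, 0 < τ ∧ ∀ r, F r = τ * r + β := by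
  have hadd : ∀ p q, F (p + q) - F 0 = (F p - F 0) + (F q - F 0) := by
    intro p q
    have e : ∀ p q, F (p + q) = g (p / a) + h (q / b) := fun p q => by
      rw [← H]
      congr 1
      field_simp
    have h1 := e p q
    have h2 := e p 0
    have h3 := e 0 q
    have h4 := e 0 0
    simp only [add_zero, zero_add] at h2 h3 h4
    linarith
  let L : ℝ →+ ℝ :=
    { toFun := fun r => F r - F 0, map_zero' := sub_self _, map_add' := hadd }
  have hL : Continuous L :=
    (hF.monotone.continuous_of_surjective hsurj).sub continuous_const
  have hlin : ∀ r, F r - F 0 = r * (F 1 - F 0) := fun r => by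
    have := map_real_smul L hL r 1
    simpa [L] using this
  refine ⟨F 1 - F 0, F 0, sub_pos.2 (hF one_pos), fun r => ?_⟩
  linarith [hlin r]

/-- A function compatible with segments is linear up to a constant. -/
theorem exists_linearMap_of_segment {V : Type*} [AddCommGroup V] [Module ℝ V] {G : X → V}
    (H : ∀ (x y : X) (t : ℝ), 0 < t → t < 1 →
      G (t • x + (1 - t) • y) = t • G x + (1 - t) • G y) :
    ∃ L : X →ₗ[ℝ] V, ∀ x, G x = L x + G 0 := by
  have hsmul : ∀ (t : ℝ) (x : X), 0 < t → t < 1 → G (t • x) - G 0 = t • (G x - G 0) := by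
    intro t x h0 h1
    have := H x 0 t h0 h1
    rw [smul_zero, add_zero] at this
    rw [this]
    module
  have hadd : ∀ x y : X, G (x + y) - G 0 = (G x - G 0) + (G y - G 0) := by
    intro x y
    have h1 := hsmul (1 / 2) (x + y) (by norm_num) (by norm_num)
    have h2 := H x y (1 / 2) (by norm_num) (by norm_num)
    have h3 : (1 / 2 : ℝ) • x + (1 - 1 / 2 : ℝ) • y = (1 / 2 : ℝ) • (x + y) := by module
    rw [h3] at h2
    rw [h2] at h1
    have h4 : (2 : ℝ) • ((1 / 2 : ℝ) • (G (x + y) - G 0)) = G (x + y) - G 0 := by module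
    rw [← h4, ← h1]
    module
  have hneg : ∀ x : X, G (-x) - G 0 = -(G x - G 0) := by
    intro x
    have := hadd (-x) x
    rw [neg_add_cancel, sub_self] at this
    exact eq_neg_of_add_eq_zero_left this.symm
  have hpos : ∀ (t : ℝ) (x : X), 0 < t → G (t • x) - G 0 = t • (G x - G 0) := by
    intro t x h0
    rcases lt_trichotomy t 1 with h1 | rfl | h1
    · exact hsmul t x h0 h1
    · simp
    · have := hsmul t⁻¹ (t • x) (inv_pos.2 h0) (inv_lt_one_of_one_lt₀ h1)
      rw [smul_smul, inv_mul_cancel₀ h0.ne', one_smul] at this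
      rw [this, smul_smul, mul_inv_cancel₀ h0.ne', one_smul]
  refine ⟨{ toFun := fun x => G x - G 0, map_add' := hadd, map_smul' := fun t x => ?_ },
    fun x => by simp⟩
  rcases lt_trichotomy t 0 with h0 | rfl | h0
  · have := hpos (-t) x (neg_pos.2 h0)
    rw [neg_smul, hneg, neg_smul, neg_inj] at this
    exact this
  · simp
  · exact hpos t x h0

/-- A positive function compatible with segments is constant. -/
theorem eq_of_pos_of_segment {g : X → ℝ} (hg : ∀ x, 0 < g x)
    (H : ∀ (x y : X) (t : ℝ), 0 < t → t < 1 →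
      g (t • x + (1 - t) • y) = t * g x + (1 - t) * g y) (x y : X) : g x = g y := by
  obtain ⟨L, hL⟩ := exists_linearMap_of_segment (G := g) H
  have hzero : ∀ x, L x = 0 := by
    intro x
    by_contra hx
    -- On this multiple of `x` the function `g` would vanish.
    have := hL ((-(g 0) / L x) • x)
    rw [map_smul, smul_eq_mul, div_mul_cancel₀ _ hx, neg_add_cancel] at this
    exact (hg _).ne' this
  rw [hL x, hL y, hzero, hzero]

/-- A linear functional which is lower semicontinuous up to a constant is continuous. -/
theorem LinearMap.continuous_of_lowerSemicontinuous {l : X →ₗ[ℝ] ℝ} {b : ℝ}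
    (hl : LowerSemicontinuous fun x => ((l x + b : ℝ) : EReal)) : Continuous l := by
  have hev : ∀ ε : ℝ, 0 < ε → ∀ᶠ x in nhds (0 : X), -ε < l x := by
    intro ε hε
    have := hl 0 ((b - ε : ℝ) : EReal) (by
      simp only [map_zero, gt_iff_lt, EReal.coe_lt_coe_iff]
      linarith)
    filter_upwards [this] with x hx
    simp only [gt_iff_lt, EReal.coe_lt_coe_iff] at hx
    linarith
  refine continuous_of_continuousAt_zero l ?_
  rw [ContinuousAt, map_zero, Metric.tendsto_nhds]
  intro ε hε
  -- Semicontinuity bounds `l` only from below; the bound at `-x` supplies the upper one.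
  have hn : Filter.Tendsto (fun x : X => -x) (nhds 0) (nhds 0) := by
    simpa using (continuous_neg (G := X)).tendsto 0
  filter_upwards [hev ε hε, hn.eventually (hev ε hε)] with x h1 h2
  rw [map_neg] at h2
  rw [Real.dist_eq, sub_zero, abs_lt]
  constructor <;> linarith

/-- A linear map between Banach spaces which is continuous for the weak topologies is bounded. -/
theorem LinearMap.continuous_of_forall_dual [CompleteSpace X] (A : X →ₗ[ℝ] X)
    (hA : ∀ u : StrongDual ℝ X, Continuous fun x => u (A x)) : Continuous A := by
  refine A.continuous_of_seq_closed_graph fun v x y hv hAv => ?_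
  by_contra hne
  obtain ⟨u, hu⟩ := SeparatingDual.exists_separating_of_ne (R := ℝ) hne
  exact hu (tendsto_nhds_unique ((u.continuous.tendsto y).comp hAv)
    (((hA u).tendsto x).comp hv))

/-! ### The action on point functions -/

theorem FullyOrderPreserving.exists_eq_pointFun_iff {T : LscProperConvex X → LscProperConvex X}
    (hT : FullyOrderPreserving T) (f : LscProperConvex X) :
    (∃ x r, T f = pointFun x r) ↔ ∃ x r, f = pointFun x r := by
  rw [_root_.exists_eq_pointFun_iff, _root_.exists_eq_pointFun_iff, hT.2.forall₂]
  simp only [← hT.1]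

theorem FullyOrderPreserving.exists_pointFun_map {T : LscProperConvex X → LscProperConvex X}
    (hT : FullyOrderPreserving T) :
    ∃ (B : X → X) (ψ : X → ℝ → ℝ), Function.Bijective B ∧ (∀ x, StrictMono (ψ x)) ∧
      (∀ x, Function.Surjective (ψ x)) ∧
      ∀ x r, T (pointFun x r) = pointFun (B x) (ψ x r) := by
  have h := fun x r => (hT.exists_eq_pointFun_iff (pointFun x r)).2 ⟨x, r, rfl⟩
  choose b s hbs using h
  -- Comparable point functions share their base point, so vertical lines go to vertical lines.
  have hb : ∀ x r, b x r = b x 0 := by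
    intro x r
    rcases le_total r 0 with hr | hr
    · have := (hT.1 _ _).1 (pointFun_le_pointFun_iff.2 ⟨rfl, hr⟩ : pointFun x r ≤ pointFun x 0)
      rw [hbs, hbs, pointFun_le_pointFun_iff] at this
      exact this.1.symm
    · have := (hT.1 _ _).1 (pointFun_le_pointFun_iff.2 ⟨rfl, hr⟩ : pointFun x 0 ≤ pointFun x r)
      rw [hbs, hbs, pointFun_le_pointFun_iff] at this
      exact this.1
  have hle : ∀ x y r t, (b y 0 = b x 0 ∧ s x r ≤ s y t) ↔ y = x ∧ r ≤ t := by
    intro x y r t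
    rw [← pointFun_le_pointFun_iff (X := X) (x := x), hT.1, hbs, hbs,
      pointFun_le_pointFun_iff, hb x r, hb y t]
  have hinj : Function.Injective fun x => b x 0 := by
    intro x y hxy
    rcases le_total (s x 0) (s y 0) with h | h
    · exact ((hle x y 0 0).1 ⟨hxy.symm, h⟩).1.symm
    · exact ((hle y x 0 0).1 ⟨hxy, h⟩).1
  have hsurj : ∀ y t, ∃ x r, b x 0 = y ∧ s x r = t := by
    intro y t
    obtain ⟨f, hf⟩ := hT.2 (pointFun y t)
    obtain ⟨x, r, rfl⟩ := (hT.exists_eq_pointFun_iff f).1 ⟨y, t, hf⟩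
    rw [hbs, hb] at hf
    have h1 := pointFun_le_pointFun_iff.1 hf.le
    have h2 := pointFun_le_pointFun_iff.1 hf.ge
    exact ⟨x, r, h2.1, le_antisymm h1.2 h2.2⟩
  refine ⟨fun x => b x 0, s, ⟨hinj, fun y => ?_⟩, fun x => ?_, fun x t => ?_, fun x r => ?_⟩
  · obtain ⟨x, r, h, -⟩ := hsurj y 0
    exact ⟨x, h⟩
  · refine strictMono_of_le_iff_le fun r t => ?_
    simpa using (hle x x r t).symm
  · obtain ⟨y, r, h, hr⟩ := hsurj (b x 0) t
    obtain rfl := hinj h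
    exact ⟨r, hr⟩
  · rw [hbs, hb]

/-- The common-minorant criterion for segments is transported by `T`. As `B x ≠ B y`, the position
of `B z` determines the weight `t'`, which is therefore independent of the heights. -/
theorem FullyOrderPreserving.interpolate {T : LscProperConvex X → LscProperConvex X}
    (hT : FullyOrderPreserving T) {B : X → X} {ψ : X → ℝ → ℝ} (hB : Function.Injective B)
    (hmono : ∀ x, StrictMono (ψ x)) (hsurj : ∀ x, Function.Surjective (ψ x))
    (hBψ : ∀ x r, T (pointFun x r) = pointFun (B x) (ψ x r)) {x y : X} (hxy : x ≠ y)
    {t : ℝ} (h0 : 0 < t) (h1 : t < 1) :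
    ∃ t' : ℝ, B (t • x + (1 - t) • y) = t' • B x + (1 - t') • B y ∧
      ∀ r s, ψ (t • x + (1 - t) • y) (t * r + (1 - t) * s) =
        t' * ψ x r + (1 - t') * ψ y s := by
  set z := t • x + (1 - t) • y with hz
  have uniq : ∀ {u v : X} {a b : ℝ}, u ≠ v → a • u + (1 - a) • v = b • u + (1 - b) • v →
      a = b := by
    intro u v a b huv h
    have : (a - b) • (u - v) = 0 := by
      have := sub_eq_zero.2 h
      rw [← this]
      module
    rcases smul_eq_zero.1 this with h | h
    · linarith
    · exact absurd (sub_eq_zero.1 h) huv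
  have key : ∀ r s q, (∃ a b : ℝ, 0 ≤ a ∧ 0 ≤ b ∧ a + b = 1 ∧ z = a • x + b • y ∧
      a * r + b * s ≤ q) ↔ ∃ a b : ℝ, 0 ≤ a ∧ 0 ≤ b ∧ a + b = 1 ∧ B z = a • B x + b • B y ∧
      a * ψ x r + b * ψ y s ≤ ψ z q := by
    intro r s q
    refine (forall_le_pointFun_iff hxy).symm.trans ?_
    rw [← forall_le_pointFun_iff (hB.ne hxy), ← hBψ, ← hBψ, ← hBψ]
    refine Iff.trans ?_ hT.2.forall.symm
    simp only [← hT.1]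
  have fwd : ∀ r s, ∃ a : ℝ, 0 ≤ a ∧ a ≤ 1 ∧ B z = a • B x + (1 - a) • B y ∧
      a * ψ x r + (1 - a) * ψ y s ≤ ψ z (t * r + (1 - t) * s) := by
    intro r s
    obtain ⟨a, b, ha, hb, hab, h, h'⟩ := (key r s (t * r + (1 - t) * s)).1
      ⟨t, 1 - t, h0.le, by linarith, by ring, hz, le_rfl⟩
    obtain rfl : b = 1 - a := by linarith
    exact ⟨a, ha, by linarith, h, h'⟩
  obtain ⟨t', ht0, ht1, hBz, -⟩ := fwd 0 0
  refine ⟨t', hBz, fun r s => le_antisymm ?_ ?_⟩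
  -- The reverse inequality comes from pulling the image segment back.
  · obtain ⟨q, hq⟩ := hsurj z (t' * ψ x r + (1 - t') * ψ y s)
    obtain ⟨a, b, ha, hb, hab, h, h'⟩ := (key r s q).2
      ⟨t', 1 - t', ht0, by linarith, by ring, hBz, hq.ge⟩
    obtain rfl : b = 1 - a := by linarith
    obtain rfl : t = a := uniq hxy (hz ▸ h)
    rw [← hq]
    exact (hmono z).monotone h'
  · obtain ⟨a, -, -, h, h'⟩ := fwd r s
    obtain rfl : t' = a := uniq (hB.ne hxy) (hBz ▸ h)
    exact h'

theorem FullyOrderPreserving.exists_affine [Nontrivial X]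
    {T : LscProperConvex X → LscProperConvex X} (hT : FullyOrderPreserving T) :
    ∃ (L : X ≃ₗ[ℝ] X) (c : X) (l : X →ₗ[ℝ] ℝ) (β τ : ℝ), 0 < τ ∧
      ∀ x r, T (pointFun x r) = pointFun (L x + c) (τ * r + l x + β) := by
  obtain ⟨B, ψ, hB, hmono, hsurj, hBψ⟩ := hT.exists_pointFun_map
  have hint := fun {x y : X} (hxy : x ≠ y) {t : ℝ} =>
    hT.interpolate hB.1 hmono hsurj hBψ hxy (t := t)
  have haff : ∀ z, ∃ τ β : ℝ, 0 < τ ∧ ∀ r, ψ z r = τ * r + β := by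
    intro z
    obtain ⟨v, hv⟩ := exists_ne (0 : X)
    -- Every point is the midpoint of two distinct points, which puts `ψ z` into Pexider's equation.
    have hne : z + v ≠ z - v := by
      intro h
      apply hv
      have : (2 : ℝ) • v = 0 := by
        have := sub_eq_zero.2 h
        rw [← this]
        module
      simpa using this
    obtain ⟨t', -, ht'⟩ := hint hne (t := 1 / 2) (by norm_num) (by norm_num)
    have hz : (1 / 2 : ℝ) • (z + v) + (1 - 1 / 2 : ℝ) • (z - v) = z := by module
    rw [hz] at ht'
    exact exists_affine_of_pexider (hmono z) (hsurj z) (by norm_num) (by norm_num) ht'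
  choose τ β hτ hψ using haff
  have hcoef : ∀ {x y : X}, x ≠ y → ∀ {t : ℝ}, 0 < t → t < 1 → ∃ t' : ℝ,
      B (t • x + (1 - t) • y) = t' • B x + (1 - t') • B y ∧
      τ (t • x + (1 - t) • y) * t = t' * τ x ∧
      τ (t • x + (1 - t) • y) * (1 - t) = (1 - t') * τ y ∧
      β (t • x + (1 - t) • y) = t' * β x + (1 - t') * β y := by
    intro x y hxy t h0 h1
    obtain ⟨t', hBz, ht'⟩ := hint hxy h0 h1
    simp only [hψ] at ht'
    have e00 := ht' 0 0
    have e10 := ht' 1 0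
    have e01 := ht' 0 1
    exact ⟨t', hBz, by linarith, by linarith, by linarith⟩
  have hτc : ∀ x, τ x = τ 0 := by
    intro x
    -- Since the weights `t'` and `1 - t'` sum to one, it is the reciprocal of `τ` that is affine
    -- along segments.
    refine inv_injective (eq_of_pos_of_segment (g := fun x => (τ x)⁻¹)
      (fun x => inv_pos.2 (hτ x)) (fun x y t h0 h1 => ?_) x 0)
    by_cases hxy : x = y
    · subst hxy
      rw [← add_smul, ← add_mul]
      simp
    · obtain ⟨t', -, h2, h3, -⟩ := hcoef hxy h0 h1
      have hx := (hτ x).ne'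
      have hy := (hτ y).ne'
      have hz := (hτ (t • x + (1 - t) • y)).ne'
      generalize τ (t • x + (1 - t) • y) = p at *
      have h4 : t' = p * t / τ x := by rw [h2]; field_simp
      have h5 : 1 - t' = p * (1 - t) / τ y := by rw [h3]; field_simp
      have h6 : p * (t / τ x + (1 - t) / τ y) = 1 := by
        have : p * t / τ x + p * (1 - t) / τ y = 1 := by rw [← h4, ← h5]; ring
        linear_combination this
      rw [inv_eq_of_mul_eq_one_right h6]
      simp only [div_eq_mul_inv]
  have hseg : ∀ (x y : X) (t : ℝ), 0 < t → t < 1 →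
      B (t • x + (1 - t) • y) = t • B x + (1 - t) • B y ∧
      β (t • x + (1 - t) • y) = t • β x + (1 - t) • β y := by
    intro x y t h0 h1
    by_cases hxy : x = y
    · subst hxy
      simp only [← add_smul, add_sub_cancel, one_smul, and_self]
    · obtain ⟨t', h1, h2, -, h4⟩ := hcoef hxy h0 h1
      rw [hτc, hτc x, mul_comm] at h2
      -- A constant slope leaves no projective distortion of the weights.
      obtain rfl : t = t' := mul_right_cancel₀ (hτ 0).ne' h2
      exact ⟨h1, h4⟩
  obtain ⟨L, hL⟩ := exists_linearMap_of_segment fun x y t h0 h1 => (hseg x y t h0 h1).1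
  obtain ⟨l, hl⟩ := exists_linearMap_of_segment fun x y t h0 h1 => (hseg x y t h0 h1).2
  have hbij : Function.Bijective L := by
    constructor
    · intro x y h
      apply hB.1
      rw [hL x, hL y, h]
    · intro y
      obtain ⟨x, hx⟩ := hB.2 (y + B 0)
      exact ⟨x, add_right_cancel ((hL x).symm.trans hx)⟩
  refine ⟨LinearEquiv.ofBijective L hbij, B 0, l, β 0, τ 0, hτ 0, fun x r => ?_⟩
  rw [hBψ, hψ, hτc, hL, hl, LinearEquiv.ofBijective_apply, add_assoc]

/-! ### Recovery of the formula and continuity -/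

theorem FullyOrderPreserving.exists_eq [CompleteSpace X] [Nontrivial X]
    {T : LscProperConvex X → LscProperConvex X} (hT : FullyOrderPreserving T) :
    ∃ (c : X) (w : StrongDual ℝ X) (β : ℝ) (τ : ℝ) (E : X ≃L[ℝ] X), 0 < τ ∧
      ∀ (f : LscProperConvex X) (x : X),
        (T f).1 x = (τ : EReal) * f.1 (E x + c) + ((w x : ℝ) : EReal) + (β : EReal) := by
  obtain ⟨L, c, l, β, τ, hτ, hL⟩ := hT.exists_affine
  have hval : ∀ (f : LscProperConvex X) (y : X), (T f).1 y =
      (τ : EReal) * f.1 (L.symm y - L.symm c) + ((l (L.symm y) : ℝ) : EReal) +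
        ((β - l (L.symm c) : ℝ) : EReal) := by
    intro f y
    obtain ⟨x, rfl⟩ : ∃ x, L x + c = y := ⟨L.symm (y - c), by simp⟩
    refine EReal.eq_of_forall_le_coe_iff fun q => ?_
    obtain ⟨r, rfl⟩ : ∃ r, τ * r + l x + β = q := ⟨(q - l x - β) / τ, by field_simp; ring⟩
    rw [EReal.mul_add_add_le_coe_iff hτ, ← le_pointFun_iff, ← hL, ← hT.1, le_pointFun_iff]
    have e1 : L.symm (L x + c) - L.symm c = x := by simp
    rw [e1]
    congr! 2
    simp only [map_add, LinearEquiv.symm_apply_apply]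
    field_simp
    ring
  -- Up to a constant this functional is the image under `T` of `u`, hence lower semicontinuous.
  -- Taking `u = 0` isolates the `l` part.
  have hcont : ∀ u : StrongDual ℝ X,
      Continuous (τ • (u : X →ₗ[ℝ] ℝ).comp L.symm.toLinearMap + l.comp L.symm.toLinearMap) := by
    intro u
    let f : LscProperConvex X := ⟨_, isLscProperConvex_affineOn convex_univ isClosed_univ
      ⟨0, trivial⟩ u 0⟩
    refine LinearMap.continuous_of_lowerSemicontinuous
      (b := β - l (L.symm c) - τ * u (L.symm c)) ?_
    convert (T f).2.lsc using 2 with y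
    rw [hval]
    simp only [f, affineOn, Set.mem_univ, if_true]
    norm_cast
    simp
    ring
  have hl : Continuous (l.comp L.symm.toLinearMap) := by
    simpa using hcont 0
  have hLs : Continuous L.symm := by
    refine LinearMap.continuous_of_forall_dual L.symm.toLinearMap fun u => ?_
    convert ((hcont u).sub hl).const_smul τ⁻¹ using 2 with x
    simp [hτ.ne']
  refine ⟨-L.symm c, ⟨_, hl⟩, β - l (L.symm c), τ,
    L.symm.toContinuousLinearEquivOfContinuous hLs, hτ, fun f x => ?_⟩
  rw [hval, sub_eq_add_neg (L.symm x)]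
  rfl

end OrderPreserving

theorem theorem1 {X : Type*} [NormedAddCommGroup X] [NormedSpace ℝ X] [CompleteSpace X]
    [Nontrivial X] (T : LscProperConvex X → LscProperConvex X) :
    FullyOrderPreserving T ↔
      ∃ (c : X) (w : StrongDual ℝ X) (β : ℝ) (τ : ℝ) (E : X ≃L[ℝ] X), 0 < τ ∧
        ∀ (f : LscProperConvex X) (x : X),
          (T f).1 x = (τ : EReal) * f.1 (E x + c) + ((w x : ℝ) : EReal) + (β : EReal) := by
  exact ⟨fun hT => hT.exists_eq, fun ⟨_, _, _, _, _, hτ, h⟩ => fullyOrderPreserving_of_eq hτ h⟩
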